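/- A one-dimensional multi-mode system consists of a finite set $M$ of modes, a slope $A(m)\in\mathbb R$, a cost per time unit $\pi_c(m)\ge 0$ and a switching cost $\pi_d(m)\ge 0$ for each mode $m$, and numbers $V_{\min}<V_{\max}$ and $V_0\in[V_{\min},V_{\max}]$. A (finite) schedule with time horizon $T$ is a finite sequence $\sigma=\langle(m_1,t_1),\dots,(m_k,t_k)\rangle$ of timed actions with $t_i>0$ and $\sum_i t_i=T$; its run is $V_0,V_1,\dots,V_k$ with $V_i=V_{i-1}+A(m_i)t_i$; it is safe if every $V_i$ lies in $[V_{\min},V_{\max}]$; its cost is $\pi(\sigma)=\sum_i(\pi_d(m_i)+\pi_c(m_i)t_i)$. It is angular if consecutive timed actions have different slopes. A timed action $(m,t)$ is a flat step if $A(m)=0$; an up step if $A(m)>0$ and it ends at $V_{\max}$; a down step if $A(m)<0$ and it ends at $V_{\min}$; a partial-up (partial-down) step if $A(m)>0$ ($A(m)<0$) and it ends strictly between $V_{\min}$ and $V_{\max}$. A leap is a pair of consecutive timed actions, the first raising the state by exactly $V_{\max}-V_{\min}$ with a mode of positive slope, the second lowering it by the same amount with a mode of negative slope. The ten head patterns are: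 (a) flat+down, (b) down, (c) partial-up+down, (d) flat+up+down, (e) up+down, (f) partial-down+up+down, (g) partial-up+up+down, (h) partial-down+down, (i) up+partial-down+down, (j) empty. The ten tail patterns are: (a) partial-up, (b) partial-up+up, (c) up+partial-down+down, (d) up+partial-down, (e) up, (f) partial-up+down, (g) partial-up+up+down, (h) partial-up+down+up, (i) up+partial-down+down+up, (j) empty. Call a pair (head pattern, tail pattern) admissible if the tail pattern is (e) or (j), or the head pattern is (b), (e) or (j); there are exactly $44$ admissible pairs. A schedule is in standard form with a pair $(h,t)$ if it is the concatenation of a head section that follows the pattern $h$ (from $V_0$), a possibly empty sequence of leaps, and a tail section that starts at $V_{\min}$ and follows the pattern $t$. Theorem. For every safe schedule $\sigma$ with time horizon $T$ there is a safe angular schedule $\sigma'$ with the same time horizon $T$, in which at most the first timed action uses a mode of slope $0$, such that $\pi(\sigma')\le\pi(\sigma)$ and one of the following holds: 1. $\sigma'$ is in standard form with one of the $44$ admissible pairs, where moreover the head and the tail pattern together have length at most five; 2. $\sigma'$ has length at most two, and $V_0=V_{\min}$ or the run of $\sigma$ does not visit $V_{\min}$; 3. the run of $\sigma$ does not visit $V_{\min}$,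 and $\sigma'$ consists of exactly three timed actions that follow the pattern up+partial-down+up. In particular, if $V_0\neq V_{\min}$ and some timed action of $\sigma$ ends at $V_{\min}$, then $\sigma'$ can be taken in standard form as in 1. -/

import Mathlib

/-- A one-dimensional multi-mode system with discrete costs over the set `M` of modes. -/
structure MultiModeSystem (M : Type*) where
  slope : M → ℝ
  /-- cost per time unit spent in a mode -/
  contCost : M → ℝ
  /-- cost of switching to a mode -/
  discCost : M → ℝ
  vMin : ℝ
  vMax : ℝ
  v0 : ℝ
  contCost_nonneg : ∀ m, 0 ≤ contCost m
  discCost_nonneg : ∀ m, 0 ≤ discCost m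
  vMin_lt_vMax : vMin < vMax
  vMin_le_v0 : vMin ≤ v0
  v0_le_vMax : v0 ≤ vMax

/-- Elementary steps from which the head and tail patterns are composed. -/
inductive Step
  | flat | up | partialUp | down | partialDown
  deriving DecidableEq

/-- The ten head patterns, (a) to (j). -/
inductive HeadPattern
  | flat_down | down | partialUp_down | flat_up_down | up_down | partialDown_up_down
  | partialUp_up_down | partialDown_down | up_partialDown_down | empty
  deriving DecidableEq

/-- The ten tail patterns, (a) to (j). -/
inductive TailPattern
  | partialUp | partialUp_up | up_partialDown_down | up_partialDown | up | partialUp_down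
  | partialUp_up_down | partialUp_down_up | up_partialDown_down_up | empty
  deriving DecidableEq

instance : Fintype HeadPattern where
  elems := {.flat_down, .down, .partialUp_down, .flat_up_down, .up_down,
    .partialDown_up_down, .partialUp_up_down, .partialDown_down, .up_partialDown_down, .empty}
  complete := by intro x; cases x <;> decide

instance : Fintype TailPattern where
  elems := {.partialUp, .partialUp_up, .up_partialDown_down, .up_partialDown, .up,
    .partialUp_down, .partialUp_up_down, .partialUp_down_up, .up_partialDown_down_up, .empty}
  complete := by intro x; cases x <;> decide

def HeadPattern.steps : HeadPattern → List Step
  | .flat_down => [.flat, .down]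
  | .down => [.down]
  | .partialUp_down => [.partialUp, .down]
  | .flat_up_down => [.flat, .up, .down]
  | .up_down => [.up, .down]
  | .partialDown_up_down => [.partialDown, .up, .down]
  | .partialUp_up_down => [.partialUp, .up, .down]
  | .partialDown_down => [.partialDown, .down]
  | .up_partialDown_down => [.up, .partialDown, .down]
  | .empty => []

def TailPattern.steps : TailPattern → List Step
  | .partialUp => [.partialUp]
  | .partialUp_up => [.partialUp, .up]
  | .up_partialDown_down => [.up, .partialDown, .down]
  | .up_partialDown => [.up, .partialDown]
  | .up => [.up]
  | .partialUp_down => [.partialUp, .down]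
  | .partialUp_up_down => [.partialUp, .up, .down]
  | .partialUp_down_up => [.partialUp, .down, .up]
  | .up_partialDown_down_up => [.up, .partialDown, .down, .up]
  | .empty => []

/-- The combinations of head and tail patterns to be considered: the tails `up` and `empty` go with
every head, the other tails only with the heads `down`, `up_down` and `empty`. -/
def patternCombinations : Finset (HeadPattern × TailPattern) :=
  Finset.univ.filter fun p =>
    (p.2 = .up ∨ p.2 = .empty) ∨ (p.1 = .down ∨ p.1 = .up_down ∨ p.1 = .empty)

namespace MultiModeSystem

variable {M : Type*} (S : MultiModeSystem M)

/-- The state after performing, from state `v`, the timed action `a = (m, t)`. -/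
def next (v : ℝ) (a : M × ℝ) : ℝ := v + S.slope a.1 * a.2

/-- The sequence of states visited by a finite sequence of timed actions started in `v`. -/
def runFrom : ℝ → List (M × ℝ) → List ℝ
  | v, [] => [v]
  | v, a :: σ => v :: runFrom (S.next v a) σ

/-- The run `⟨V₀, V₁, …, V_k⟩` of a schedule; it includes the initial state. -/
def run (σ : List (M × ℝ)) : List ℝ := S.runFrom S.v0 σ

/-- The last state of the run. -/
def endState (σ : List (M × ℝ)) : ℝ := σ.foldl S.next S.v0

/-- `σ` is a schedule (all delays are positive) with finite time horizon `T`. -/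
def IsSchedule (T : ℝ) (σ : List (M × ℝ)) : Prop :=
  (∀ a ∈ σ, 0 < a.2) ∧ (σ.map Prod.snd).sum = T

/-- `σ` is a safe schedule with finite time horizon `T`. -/
def IsSafeSchedule (T : ℝ) (σ : List (M × ℝ)) : Prop :=
  IsSchedule T σ ∧ ∀ v ∈ S.run σ, S.vMin ≤ v ∧ v ≤ S.vMax

/-- The total cost of a schedule. -/
def cost (σ : List (M × ℝ)) : ℝ :=
  (σ.map fun a => S.discCost a.1 + S.contCost a.1 * a.2).sum

/-- No two consecutive timed actions have the same slope. -/
def IsAngular (σ : List (M × ℝ)) : Prop :=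
  σ.IsChain fun a b => S.slope a.1 ≠ S.slope b.1

/-- A zero-mode can only be used by the very first timed action. -/
def ZeroModeOnlyFirst (σ : List (M × ℝ)) : Prop :=
  ∀ a ∈ σ.tail, S.slope a.1 ≠ 0

/-- The timed action `a`, started in state `v`, is a step of the given kind. A step up (down) leads
to the upper (lower) border, a partial one to a state that is not at the border. -/
def IsStep (v : ℝ) (a : M × ℝ) : Step → Prop
  | .flat => S.slope a.1 = 0
  | .up => 0 < S.slope a.1 ∧ S.next v a = S.vMax
  | .partialUp => 0 < S.slope a.1 ∧ S.vMin < S.next v a ∧ S.next v a < S.vMax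
  | .down => S.slope a.1 < 0 ∧ S.next v a = S.vMin
  | .partialDown => S.slope a.1 < 0 ∧ S.vMin < S.next v a ∧ S.next v a < S.vMax

/-- The sequence of timed actions, started in state `v`, follows the given sequence of steps. -/
def Follows : ℝ → List (M × ℝ) → List Step → Prop
  | _, [], [] => True
  | v, a :: σ, s :: p => S.IsStep v a s ∧ Follows (S.next v a) σ p
  | _, _, _ => False

/-- The pair of timed actions `a`, `b` is a (complete) leap. -/
def IsLeap (a b : M × ℝ) : Prop :=
  0 < S.slope a.1 ∧ S.slope b.1 < 0 ∧ S.slope a.1 * a.2 + S.slope b.1 * b.2 = 0 ∧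
    S.slope a.1 * a.2 = S.vMax - S.vMin

/-- The sequence of timed actions consists of leaps only, possibly of different types. -/
def IsLeapsSection (σ : List (M × ℝ)) : Prop :=
  ∃ L : List ((M × ℝ) × (M × ℝ)),
    (∀ p ∈ L, S.IsLeap p.1 p.2) ∧ σ = L.flatMap fun p => [p.1, p.2]

/-- `σ` consists of a head section with pattern `h`, a leaps section, and a tail section with pattern
`t` that starts at `vMin`. -/
def HasForm (σ : List (M × ℝ)) (h : HeadPattern) (t : TailPattern) : Prop :=
  ∃ head leaps tail : List (M × ℝ), σ = head ++ leaps ++ tail ∧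
    S.Follows S.v0 head h.steps ∧
    S.IsLeapsSection leaps ∧
    S.endState (head ++ leaps) = S.vMin ∧
    S.Follows S.vMin tail t.steps

end MultiModeSystem

/-! ### Shortest dominating schedules -/

namespace MultiModeSystem

variable {M : Type*} (S : MultiModeSystem M)

/-! Among the schedules that dominate `σ`, take one with the fewest timed actions. Minimising length
rather than cost needs no compactness, and it already gives most of the structure. Two neighbours of
equal slope could be merged, so the schedule is angular (`IsShortest.isAngular`). Actions of slope
zero can be moved to the front and merged there, so at most one exists
(`exists_isShortest_zeroModeOnlyFirst`).

The core is a linear perturbation. Fix the modes and regard the `k` durations as variables: horizon,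
states and cost are affine in them. If two states after the start lie off the border, fixing the
horizon and the other `k - 2` states imposes only `k - 1` linear conditions, so some nonzero
direction remains, and its sign can be chosen so that the cost does not rise
(`exists_perturbation`). Following it until a constraint becomes tight either makes a duration
vanish, contradicting minimal length, or brings one more state to the border. With the number of
states off the border minimal as well, at most one such state remains after the start
(`IsShortest.exists_durations`). A flat first action supplies a degree of freedom of its own, so
then no later state lies off the border.

What remains is combinatorial. A run that only hits borders alternates between them, hence consists
of leaps apart from its first steps and a possible last step up. Around the single exceptional
state, timed actions are permuted into the listed patterns. A permutation keeps horizon, cost and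
length; the standard form itself guarantees safety and a visit to `vMin`. The result is therefore
again shortest, hence angular (`IsShortest.of_perm`). -/

lemma left_mem_runFrom (v : ℝ) (σ : List (M × ℝ)) : v ∈ S.runFrom v σ := by
  cases σ <;> simp [runFrom]

lemma mem_runFrom_append {v w : ℝ} {l₁ l₂ : List (M × ℝ)} :
    w ∈ S.runFrom v (l₁ ++ l₂) ↔
      w ∈ S.runFrom v l₁ ∨ w ∈ S.runFrom (l₁.foldl S.next v) l₂ := by
  induction l₁ generalizing v with
  | nil =>
    have := S.left_mem_runFrom v l₂
    simp only [List.nil_append, runFrom, List.mem_singleton, List.foldl_nil]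
    constructor
    · exact Or.inr
    · rintro (rfl | h) <;> assumption
  | cons a l ih => simp only [List.cons_append, runFrom, List.mem_cons, ih, List.foldl_cons, or_assoc]

lemma mem_runFrom_cons {v w : ℝ} {a : M × ℝ} {σ : List (M × ℝ)} :
    w ∈ S.runFrom v (a :: σ) ↔ w = v ∨ w ∈ S.runFrom (S.next v a) σ := by
  simp [runFrom]

lemma mem_runFrom_iff_take {v w : ℝ} {σ : List (M × ℝ)} :
    w ∈ S.runFrom v σ ↔ ∃ n ≤ σ.length, (σ.take n).foldl S.next v = w := by
  induction σ generalizing v with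
  | nil => simp [runFrom, eq_comm]
  | cons a σ ih =>
    rw [mem_runFrom_cons, ih]
    constructor
    · rintro (rfl | ⟨n, hn, h⟩)
      · exact ⟨0, by simp, by simp⟩
      · exact ⟨n + 1, by simpa using hn, by simpa using h⟩
    · rintro ⟨n, hn, h⟩
      cases n with
      | zero => left; simpa using h.symm
      | succ n => exact Or.inr ⟨n, by simpa using hn, by simpa using h⟩

lemma foldl_next (v : ℝ) (σ : List (M × ℝ)) :
    σ.foldl S.next v = v + (σ.map fun a => S.slope a.1 * a.2).sum := by
  induction σ generalizing v with
  | nil => simp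
  | cons a σ ih => simp [ih, next, add_assoc]

lemma next_of_slope_eq_zero {v : ℝ} {a : M × ℝ} (h : S.slope a.1 = 0) : S.next v a = v := by
  simp [next, h]

/-- `σ` is a safe schedule that is at most as expensive as `σ₀` and visits the lower border if
`σ₀` does. -/
def Dominates (T : ℝ) (σ₀ σ : List (M × ℝ)) : Prop :=
  S.IsSafeSchedule T σ ∧ S.cost σ ≤ S.cost σ₀ ∧ (S.vMin ∈ S.run σ₀ → S.vMin ∈ S.run σ)

/-- `σ` has minimal length among the schedules that dominate `σ₀`. -/
def IsShortest (T : ℝ) (σ₀ σ : List (M × ℝ)) : Prop :=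
  S.Dominates T σ₀ σ ∧ ∀ τ, S.Dominates T σ₀ τ → σ.length ≤ τ.length

variable {S} {T : ℝ} {σ₀ σ : List (M × ℝ)}

lemma exists_isShortest (h : S.IsSafeSchedule T σ₀) : ∃ σ, S.IsShortest T σ₀ σ := by
  obtain ⟨σ, hσ, hmin⟩ := WellFounded.has_min (measure (List.length (α := M × ℝ))).wf
    {σ | S.Dominates T σ₀ σ} ⟨σ₀, h, le_rfl, id⟩
  exact ⟨σ, hσ, fun τ hτ => not_lt.1 (hmin τ hτ)⟩

/-- Two consecutive timed actions of the same slope can be merged. -/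
lemma Dominates.exists_merge {l₁ l₂ : List (M × ℝ)} {a b : M × ℝ}
    (h : S.Dominates T σ₀ (l₁ ++ a :: b :: l₂)) (hab : S.slope a.1 = S.slope b.1) :
    ∃ c, S.Dominates T σ₀ (l₁ ++ c :: l₂) := by
  obtain ⟨⟨⟨hpos, hsum⟩, hsafe⟩, hcost, hvis⟩ := h
  have ha : 0 < a.2 := hpos a (by simp)
  have hb : 0 < b.2 := hpos b (by simp)
  -- The mode with the smaller running cost takes over the whole duration; the other switching cost
  -- is saved.
  obtain ⟨m, hm, hm'⟩ : ∃ m, S.slope m = S.slope a.1 ∧ S.discCost m + S.contCost m * (a.2 + b.2) ≤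
      S.discCost a.1 + S.contCost a.1 * a.2 + (S.discCost b.1 + S.contCost b.1 * b.2) := by
    have hda := S.discCost_nonneg a.1
    have hdb := S.discCost_nonneg b.1
    rcases le_total (S.contCost a.1) (S.contCost b.1) with hc | hc
    · exact ⟨a.1, rfl, by nlinarith⟩
    · exact ⟨b.1, hab.symm, by nlinarith⟩
  have hnext (v : ℝ) : S.next v (m, a.2 + b.2) = S.next (S.next v a) b := by
    simp only [next, hm, ← hab]; ring
  refine ⟨(m, a.2 + b.2), ⟨⟨?_, ?_⟩, ?_⟩, ?_, ?_⟩
  · intro x hx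
    simp only [List.mem_append, List.mem_cons] at hx
    rcases hx with hx | rfl | hx
    · exact hpos x (by simp [hx])
    · exact add_pos ha hb
    · exact hpos x (by simp [hx])
  · rw [← hsum]; simp; ring
  · intro w hw
    apply hsafe w
    simp only [run, mem_runFrom_append, mem_runFrom_cons, hnext] at hw ⊢
    tauto
  · refine le_trans ?_ hcost
    simp only [cost, List.map_append, List.map_cons, List.sum_append, List.sum_cons]
    linarith
  · intro hv
    have hmem := hvis hv
    simp only [run, mem_runFrom_append, mem_runFrom_cons, hnext] at hmem hsafe ⊢
    rcases hmem with h | h | h | h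
    · exact Or.inl h
    · exact Or.inr (Or.inl h)
    · set v := l₁.foldl S.next S.v0
      have h1 := (hsafe v (by tauto)).1
      have h2 := (hsafe (S.next (S.next v a) b)
        (Or.inr (Or.inr (Or.inr (S.left_mem_runFrom _ _))))).1
      -- The state lost by merging is `vMin`. The run is monotone across the pair and never below
      -- `vMin`, so one end of the merged action is `vMin` too.
      rcases le_total 0 (S.slope a.1) with hs | hs
      · refine Or.inr (Or.inl (le_antisymm h1 ?_))
        rw [h]; simp only [next]; nlinarith
      · have : S.vMin = S.next (S.next v a) b := by
          refine le_antisymm h2 ?_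
          rw [h]; simp only [next]; rw [hab] at hs; simp only [next] at *; nlinarith
        refine Or.inr (Or.inr ?_)
        rw [this]; exact S.left_mem_runFrom _ _
    · exact Or.inr (Or.inr h)

lemma IsShortest.isAngular (h : S.IsShortest T σ₀ σ) : S.IsAngular σ := by
  rw [IsAngular, List.isChain_iff_forall_rel_of_append_cons_cons]
  rintro a b l₁ l₂ rfl hab
  obtain ⟨c, hc⟩ := h.1.exists_merge hab
  have := h.2 _ hc
  simp at this

/-- A timed action of slope zero can be moved to the front. -/
lemma Dominates.flat_cons {l₁ l₂ : List (M × ℝ)} {a : M × ℝ}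
    (h : S.Dominates T σ₀ (l₁ ++ a :: l₂)) (ha : S.slope a.1 = 0) :
    S.Dominates T σ₀ (a :: (l₁ ++ l₂)) := by
  have hp : (a :: (l₁ ++ l₂)).Perm (l₁ ++ a :: l₂) := List.perm_middle.symm
  have hrun (w : ℝ) : w ∈ S.run (a :: (l₁ ++ l₂)) ↔ w ∈ S.run (l₁ ++ a :: l₂) := by
    simp only [run, mem_runFrom_append, mem_runFrom_cons, next_of_slope_eq_zero S ha]
    have h1 := S.left_mem_runFrom S.v0 l₁
    have h2 := S.left_mem_runFrom (l₁.foldl S.next S.v0) l₂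
    constructor
    · rintro (rfl | h | h) <;> tauto
    · rintro (h | rfl | h) <;> tauto
  obtain ⟨⟨⟨hpos, hsum⟩, hsafe⟩, hcost, hvis⟩ := h
  refine ⟨⟨⟨fun x hx => hpos x (hp.mem_iff.1 hx), ?_⟩, fun w hw => hsafe w ((hrun w).1 hw)⟩, ?_,
    fun hv => (hrun _).2 (hvis hv)⟩
  · rw [← hsum]; exact (hp.map _).sum_eq
  · rw [cost, (hp.map _).sum_eq]; exact hcost

/-- Moving one zero-mode to the front keeps the length. A second one could also be brought to the
front and merged with the first, contradicting minimality. -/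
lemma exists_isShortest_zeroModeOnlyFirst (h : S.IsSafeSchedule T σ₀) :
    ∃ σ, S.IsShortest T σ₀ σ ∧ S.ZeroModeOnlyFirst σ := by
  obtain ⟨σ, hσ⟩ := exists_isShortest h
  by_cases hz : ∃ a ∈ σ, S.slope a.1 = 0
  · obtain ⟨a, ha, ha0⟩ := hz
    obtain ⟨l₁, l₂, rfl⟩ := List.append_of_mem ha
    have hd := hσ.1.flat_cons ha0
    refine ⟨_, ⟨hd, fun τ hτ => ?_⟩, ?_⟩
    · have := hσ.2 τ hτ
      simp at this ⊢; omega
    · intro b hb hb0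
      obtain ⟨l₃, l₄, hl⟩ := List.append_of_mem hb
      rw [List.tail_cons] at hl
      rw [hl] at hd
      have hd' := Dominates.flat_cons (l₁ := a :: l₃) (by simpa using hd) hb0
      obtain ⟨c, hc⟩ := Dominates.exists_merge (l₁ := []) (by simpa using hd') (hb0.trans ha0.symm)
      have h1 := hσ.2 _ hc
      have h2 := congrArg List.length hl
      simp at h1 h2
      omega
  · push Not at hz
    exact ⟨σ, hσ, fun a ha => hz a (List.mem_of_mem_tail ha)⟩

end MultiModeSystem

/-! ### Perturbing the durations for fixed modes -/

namespace MultiModeSystem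

variable {M : Type*} (S : MultiModeSystem M)

/-- The state is not at one of the two borders. -/
def Inner (v : ℝ) : Prop := v ≠ S.vMin ∧ v ≠ S.vMax

/-- The schedule with modes `m i` and durations `t i`. -/
def schedule {k : ℕ} (m : Fin k → M) (t : Fin k → ℝ) : List (M × ℝ) :=
  List.ofFn fun i => (m i, t i)

/-- The change of the state caused by the first `n` timed actions of `schedule m t`. -/
def displacement {k : ℕ} (m : Fin k → M) (t : Fin k → ℝ) (n : ℕ) : ℝ :=
  ∑ i : Fin k with i.val < n, S.slope (m i) * t i

variable {S} {k : ℕ} {m : Fin k → M} {t : Fin k → ℝ}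

lemma foldl_take_schedule (v : ℝ) (n : ℕ) :
    ((schedule m t).take n).foldl S.next v = v + S.displacement m t n := by
  rw [foldl_next, schedule, List.map_take, List.map_ofFn, List.sum_take_ofFn]
  rfl

lemma mem_run_schedule {w : ℝ} :
    w ∈ S.run (schedule m t) ↔ ∃ n ≤ k, S.v0 + S.displacement m t n = w := by
  simp only [run, mem_runFrom_iff_take, foldl_take_schedule]
  simp [schedule]

/-- The switching part depends on the modes only, so for fixed modes the cost is affine in the
durations. -/
lemma cost_schedule :
    S.cost (schedule m t) = ∑ i, S.discCost (m i) + ∑ i, S.contCost (m i) * t i := by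
  simp [cost, schedule, List.map_ofFn, List.sum_ofFn, Finset.sum_add_distrib]

lemma sum_schedule : ((schedule m t).map Prod.snd).sum = ∑ i, t i := by
  simp [schedule, List.map_ofFn, List.sum_ofFn]

/-- Dropping the timed actions of duration zero. -/
lemma mem_runFrom_filter {v w : ℝ} {σ : List (M × ℝ)} (h : ∀ a ∈ σ, 0 ≤ a.2) :
    w ∈ S.runFrom v (σ.filter fun a => 0 < a.2) ↔ w ∈ S.runFrom v σ := by
  induction σ generalizing v with
  | nil => simp
  | cons a σ ih =>
    have ih' := fun v => ih (v := v) fun b hb => h b (by simp [hb])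
    rcases (h a (by simp)).eq_or_lt with ha | ha
    · rw [List.filter_cons_of_neg (by simp [← ha]), ih', mem_runFrom_cons]
      have : S.next v a = v := by simp [next, ← ha]
      rw [this]
      constructor
      · exact Or.inr
      · rintro (rfl | h)
        · exact S.left_mem_runFrom _ _
        · exact h
    · rw [List.filter_cons_of_pos (by simpa using ha), mem_runFrom_cons, mem_runFrom_cons, ih']

lemma sum_filter {σ : List (M × ℝ)} (h : ∀ a ∈ σ, 0 ≤ a.2) :
    ((σ.filter fun a => 0 < a.2).map Prod.snd).sum = (σ.map Prod.snd).sum := by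
  induction σ with
  | nil => simp
  | cons a σ ih =>
    have ih' := ih fun b hb => h b (by simp [hb])
    rcases (h a (by simp)).eq_or_lt with ha | ha
    · rw [List.filter_cons_of_neg (by simp [← ha]), ih']
      simp [← ha]
    · rw [List.filter_cons_of_pos (by simpa using ha), List.map_cons, List.sum_cons, ih']
      simp

lemma cost_filter_le {σ : List (M × ℝ)} (h : ∀ a ∈ σ, 0 ≤ a.2) :
    S.cost (σ.filter fun a => 0 < a.2) ≤ S.cost σ := by
  refine List.Sublist.sum_le_sum (List.filter_sublist.map _) fun x hx => ?_
  obtain ⟨a, ha, rfl⟩ := List.mem_map.1 hx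
  exact add_nonneg (S.discCost_nonneg _) (mul_nonneg (S.contCost_nonneg _) (h a ha))

/-- Along a ray, finitely many affine constraints hold up to a point where one becomes tight. -/
lemma exists_tight {ι : Type*} [Fintype ι] (p q : ι → ℝ) (hp : ∀ c, 0 ≤ p c)
    (hq : ∃ c, q c < 0) :
    ∃ s, (∀ c, 0 ≤ p c + s * q c) ∧ 0 ≤ s ∧ ∃ c, q c < 0 ∧ p c + s * q c = 0 := by
  classical
  obtain ⟨c₀, hc₀⟩ := hq
  obtain ⟨c, hc, hmin⟩ := Finset.exists_min_image (Finset.univ.filter fun c => q c < 0)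
    (fun c => p c / -q c) ⟨c₀, by simpa using hc₀⟩
  simp only [Finset.mem_filter, Finset.mem_univ, true_and] at hc hmin
  have hs : 0 ≤ p c / -q c := div_nonneg (hp c) (by linarith)
  refine ⟨p c / -q c, fun e => ?_, hs, c, hc, ?_⟩
  · rcases lt_or_ge (q e) 0 with he | he
    · have := hmin e he
      rw [le_div_iff₀ (by linarith)] at this
      linarith
    · exact add_nonneg (hp e) (mul_nonneg hs he)
  · have : q c ≠ 0 := hc.ne
    field_simp
    ring

lemma displacement_add_smul (d : Fin k → ℝ) (s : ℝ) (n : ℕ) :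
    S.displacement m (t + s • d) n = S.displacement m t n + s * S.displacement m d n := by
  simp only [displacement, Finset.mul_sum, ← Finset.sum_add_distrib]
  refine Finset.sum_congr rfl fun i _ => ?_
  simp; ring

/-- There is a nonzero direction that keeps the time horizon and moves only the states after the
timed actions `p` and `q`. -/
lemma exists_direction (m : Fin k → M) {p q : Fin k} (hpq : p ≠ q) :
    ∃ d : Fin k → ℝ, d ≠ 0 ∧ ∑ i, d i = 0 ∧
      ∀ l, l ≠ p → l ≠ q → S.displacement m d (l.val + 1) = 0 := by
  classical
  -- Coordinate `p` carries the horizon condition, coordinate `q` is identically zero, and the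
  -- others carry the states to be kept. An endomorphism with a zero coordinate is not surjective,
  -- hence not injective; a kernel vector is the direction sought.
  let Φ : (Fin k → ℝ) →ₗ[ℝ] (Fin k → ℝ) :=
    { toFun := fun d l =>
        if l = p then ∑ i, d i else if l = q then 0 else S.displacement m d (l.val + 1)
      map_add' := by
        intro x y
        ext l
        have := displacement_add_smul (S := S) (m := m) (t := x) y 1 (l.val + 1)
        rw [one_smul, one_mul] at this
        by_cases h1 : l = p
        · simp [h1, Finset.sum_add_distrib]
        · by_cases h2 : l = q <;> simp [h1, h2, this, hpq.symm]
      map_smul' := by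
        intro s x
        ext l
        have := displacement_add_smul (S := S) (m := m) (t := 0) x s (l.val + 1)
        rw [zero_add] at this
        by_cases h1 : l = p
        · simp [h1, Finset.mul_sum]
        · by_cases h2 : l = q
          · simp [h2, hpq.symm]
          · have h0 : S.displacement m 0 (l.val + 1) = 0 := by simp [displacement]
            simp [h1, h2, this, h0] }
  by_contra hne
  push Not at hne
  have hinj : Function.Injective Φ := by
    rw [injective_iff_map_eq_zero]
    intro d hd
    by_contra hd0
    have hΦ (l : Fin k) := congrFun hd l
    obtain ⟨l, h1, h2, h3⟩ := hne d hd0 (by simpa [Φ] using hΦ p)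
    exact h3 (by simpa [Φ, h1, h2] using hΦ l)
  obtain ⟨d, hd⟩ := LinearMap.injective_iff_surjective.1 hinj (Pi.single q 1)
  have := congrFun hd q
  simp [Φ, hpq.symm] at this

/-- If the states after two timed actions can be moved, then the durations can be changed, without
increasing the cost, until a duration vanishes or a further state reaches the border. -/
lemma exists_perturbation (ht : ∀ i, 0 < t i)
    (hsafe : ∀ n ≤ k, S.vMin ≤ S.v0 + S.displacement m t n ∧ S.v0 + S.displacement m t n ≤ S.vMax)
    {p q : Fin k} (hpq : p ≠ q) (hq : S.Inner (S.v0 + S.displacement m t (q.val + 1)))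
    (hp : S.Inner (S.v0 + S.displacement m t (p.val + 1)) ∨ p.val = 0 ∧ S.slope (m p) = 0) :
    ∃ t' : Fin k → ℝ, (∀ i, 0 ≤ t' i) ∧ ∑ i, t' i = ∑ i, t i ∧
      ∑ i, S.contCost (m i) * t' i ≤ ∑ i, S.contCost (m i) * t i ∧
      (∀ n ≤ k, S.vMin ≤ S.v0 + S.displacement m t' n ∧ S.v0 + S.displacement m t' n ≤ S.vMax) ∧
      (∀ n ≤ k, ¬ S.Inner (S.v0 + S.displacement m t n) →
        S.displacement m t' n = S.displacement m t n) ∧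
      ((∃ i, t' i = 0) ∨ ∃ n ≤ k, S.Inner (S.v0 + S.displacement m t n) ∧
        ¬ S.Inner (S.v0 + S.displacement m t' n)) := by
  obtain ⟨d, hd0, hdsum, hd, hdcost⟩ : ∃ d : Fin k → ℝ, d ≠ 0 ∧ ∑ i, d i = 0 ∧
      (∀ l, l ≠ p → l ≠ q → S.displacement m d (l.val + 1) = 0) ∧
      ∑ i, S.contCost (m i) * d i ≤ 0 := by
    obtain ⟨d, hd0, hdsum, hd⟩ := exists_direction (S := S) m hpq
    -- All conditions on `d` are invariant under negation, so the sign is free to make the cost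
    -- nonincreasing.
    rcases le_total (∑ i, S.contCost (m i) * d i) 0 with h | h
    · exact ⟨d, hd0, hdsum, hd, h⟩
    · refine ⟨-d, neg_ne_zero.2 hd0, by simp [hdsum], fun l h1 h2 => ?_, by simpa using h⟩
      have := hd l h1 h2
      simp only [displacement, Pi.neg_apply, mul_neg, Finset.sum_neg_distrib] at this ⊢
      simpa using this
  have hfix : ∀ n ≤ k, ¬ S.Inner (S.v0 + S.displacement m t n) → S.displacement m d n = 0 := by
    intro n hn hin
    cases n with
    | zero => simp [displacement]
    | succ l =>
      by_cases h2 : (⟨l, hn⟩ : Fin k) = q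
      · subst h2; exact absurd hq hin
      by_cases h1 : (⟨l, hn⟩ : Fin k) = p
      · subst h1
        -- If `p` is the flat first action, the state after it is `v0` for any durations. No
        -- condition was imposed there, yet this state does not move.
        rcases hp with hp | ⟨hp0, hp⟩
        · exact absurd hp hin
        · simp only at hp0
          refine Finset.sum_eq_zero fun i hi => ?_
          have : i = ⟨l, hn⟩ := by
            ext
            simp only [Finset.mem_filter, Finset.mem_univ, true_and] at hi
            simp only
            omega
          rw [this, hp, zero_mul]
      · exact hd _ h1 h2
  obtain ⟨i₀, hi₀⟩ : ∃ i, d i < 0 := by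
    by_contra! h
    exact hd0 (funext fun i => (Finset.sum_eq_zero_iff_of_nonneg fun i _ => h i).1 hdsum i (by simp))
  -- The constraints are nonnegative durations, states above `vMin` and states below `vMax`. Since
  -- `d` is nonzero with sum zero, some duration decreases, so the ray cannot remain feasible
  -- forever.
  obtain ⟨s, hs, hs0, c, hc, hc0⟩ := exists_tight
    (ι := Fin k ⊕ (Fin (k + 1) ⊕ Fin (k + 1)))
    (Sum.elim t (Sum.elim (fun n => S.v0 + S.displacement m t n - S.vMin)
      fun n => S.vMax - (S.v0 + S.displacement m t n)))
    (Sum.elim d (Sum.elim (fun n => S.displacement m d n) fun n => - S.displacement m d n))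
    (by
      rintro (i | n | n)
      · exact (ht i).le
      · have := hsafe n (by omega); simp; linarith
      · have := hsafe n (by omega); simp; linarith)
    ⟨Sum.inl i₀, hi₀⟩
  have hdisp (n : ℕ) := displacement_add_smul (S := S) (m := m) (t := t) d s n
  refine ⟨t + s • d, fun i => by simpa using hs (Sum.inl i), ?_, ?_, fun n hn => ?_,
    fun n hn hin => ?_, ?_⟩
  · simp [Finset.sum_add_distrib, ← Finset.mul_sum, hdsum]
  · have : ∑ i, S.contCost (m i) * (t + s • d) i =
        ∑ i, S.contCost (m i) * t i + s * ∑ i, S.contCost (m i) * d i := by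
      simp only [Finset.mul_sum, ← Finset.sum_add_distrib]
      refine Finset.sum_congr rfl fun i _ => ?_
      simp; ring
    rw [this]
    nlinarith
  · have h1 := hs (Sum.inr (Sum.inl ⟨n, by omega⟩))
    have h2 := hs (Sum.inr (Sum.inr ⟨n, by omega⟩))
    simp only [Sum.elim_inr, Sum.elim_inl] at h1 h2
    rw [hdisp]
    constructor <;> linarith
  · rw [hdisp, hfix n hn hin, mul_zero, add_zero]
  · rcases c with i | n | n
    · exact Or.inl ⟨i, by simpa using hc0⟩
    · simp only [Sum.elim_inr, Sum.elim_inl] at hc hc0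
      refine Or.inr ⟨n, by omega, not_not.1 fun hin => hc.ne (hfix n (by omega) hin), fun h => h.1 ?_⟩
      rw [hdisp]; linarith
    · simp only [Sum.elim_inr] at hc hc0
      refine Or.inr ⟨n, by omega,
        not_not.1 fun hin => hc.ne (by rw [hfix n (by omega) hin, neg_zero]), fun h => h.2 ?_⟩
      rw [hdisp]; linarith

variable {T : ℝ} {σ₀ : List (M × ℝ)}

lemma dominates_schedule_iff (ht : ∀ i, 0 < t i) :
    S.Dominates T σ₀ (schedule m t) ↔ ∑ i, t i = T ∧
      (∀ n ≤ k, S.vMin ≤ S.v0 + S.displacement m t n ∧ S.v0 + S.displacement m t n ≤ S.vMax) ∧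
      S.cost (schedule m t) ≤ S.cost σ₀ ∧
      (S.vMin ∈ S.run σ₀ → ∃ n ≤ k, S.v0 + S.displacement m t n = S.vMin) := by
  have hpos : ∀ a ∈ schedule m t, 0 < a.2 := by
    intro a ha
    obtain ⟨i, rfl⟩ := (List.mem_ofFn' _ _).1 ha
    exact ht i
  simp only [Dominates, IsSafeSchedule, IsSchedule, sum_schedule, mem_run_schedule]
  constructor
  · rintro ⟨⟨⟨-, h1⟩, h2⟩, h3, h4⟩
    exact ⟨h1, fun n hn => h2 _ ⟨n, hn, rfl⟩, h3, h4⟩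
  · rintro ⟨h1, h2, h3, h4⟩
    exact ⟨⟨⟨hpos, h1⟩, by rintro w ⟨n, hn, rfl⟩; exact h2 n hn⟩, h3, h4⟩

/-- The durations of a shortest schedule can be chosen such that no two states can be moved. -/
lemma IsShortest.exists_durations (h : S.IsShortest T σ₀ (schedule m t)) :
    ∃ t' : Fin k → ℝ, S.IsShortest T σ₀ (schedule m t') ∧
      ∀ p q : Fin k, p ≠ q → S.Inner (S.v0 + S.displacement m t' (q.val + 1)) →
        ¬ (S.Inner (S.v0 + S.displacement m t' (p.val + 1)) ∨ p.val = 0 ∧ S.slope (m p) = 0) := by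
  classical
  obtain ⟨t', hσ, hmin⟩ := WellFounded.has_min (measure fun t' : Fin k → ℝ =>
      ((Finset.range (k + 1)).filter fun n => S.Inner (S.v0 + S.displacement m t' n)).card).wf
    {t' | S.IsShortest T σ₀ (schedule m t')} ⟨t, h⟩
  refine ⟨t', hσ, fun p q hpq hq hp => ?_⟩
  have ht' : ∀ i, 0 < t' i := fun i =>
    hσ.1.1.1.1 (m i, t' i) ((List.mem_ofFn' _ _).2 ⟨i, rfl⟩)
  obtain ⟨hsum, hsafe, hcost, hvis⟩ := (dominates_schedule_iff ht').1 hσ.1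
  obtain ⟨u, hu, husum, hucost, husafe, hufix, hu'⟩ := exists_perturbation ht' hsafe hpq hq hp
  have hcost' : S.cost (schedule m u) ≤ S.cost σ₀ := by
    refine le_trans ?_ hcost
    rw [cost_schedule, cost_schedule]
    linarith
  have hvis' : S.vMin ∈ S.run σ₀ → ∃ n ≤ k, S.v0 + S.displacement m u n = S.vMin := by
    intro hv
    obtain ⟨n, hn, hn'⟩ := hvis hv
    exact ⟨n, hn, by rw [hufix n hn fun hin => hin.1 hn', hn']⟩
  -- A vanishing duration contradicts minimal length after dropping it; otherwise the perturbed
  -- schedule is still shortest but has fewer states off the border.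
  by_cases hz : ∃ i, u i = 0
  · have hnonneg : ∀ a ∈ schedule m u, 0 ≤ a.2 := by
      intro a ha
      obtain ⟨i, rfl⟩ := (List.mem_ofFn' _ _).1 ha
      exact hu i
    have hdom : S.Dominates T σ₀ ((schedule m u).filter fun a => 0 < a.2) := by
      refine ⟨⟨⟨fun a ha => by simpa using (List.mem_filter.1 ha).2, ?_⟩, ?_⟩, ?_, ?_⟩
      · rw [sum_filter hnonneg, sum_schedule, husum, hsum]
      · intro w hw
        rw [run, mem_runFrom_filter hnonneg] at hw
        obtain ⟨n, hn, rfl⟩ := mem_run_schedule.1 hw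
        exact husafe n hn
      · exact (cost_filter_le hnonneg).trans hcost'
      · intro hv
        rw [run, mem_runFrom_filter hnonneg]
        exact mem_run_schedule.2 (hvis' hv)
    obtain ⟨i, hi⟩ := hz
    have hlt : ((schedule m u).filter fun a => 0 < a.2).length < (schedule m u).length :=
      List.length_filter_lt_length_iff_exists.2
        ⟨(m i, u i), (List.mem_ofFn' _ _).2 ⟨i, rfl⟩, by simp [hi]⟩
    have := hσ.2 _ hdom
    simp only [schedule, List.length_ofFn] at this hlt
    omega
  · have hupos : ∀ i, 0 < u i := fun i => lt_of_le_of_ne (hu i) fun h => hz ⟨i, h.symm⟩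
    have hdom : S.Dominates T σ₀ (schedule m u) :=
      (dominates_schedule_iff hupos).2 ⟨husum.trans hsum, husafe, hcost', hvis'⟩
    refine hmin u ⟨hdom, fun τ hτ => by simpa [schedule] using hσ.2 τ hτ⟩ ?_
    obtain ⟨n, hn, hin, hin'⟩ := hu'.resolve_left hz
    refine Finset.card_lt_card ⟨fun j hj => ?_, fun hsub => hin' ?_⟩
    · simp only [Finset.mem_filter, Finset.mem_range] at hj ⊢
      refine ⟨hj.1, not_not.1 fun hj' => hj' ?_⟩
      rw [← hufix j (by omega) hj']
      exact hj.2
    · have := hsub (x := n) (by simp only [Finset.mem_filter, Finset.mem_range]; exact ⟨by omega, hin⟩)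
      exact (Finset.mem_filter.1 this).2

end MultiModeSystem

/-! ### Runs along the border, leaps and standard form -/

namespace MultiModeSystem

variable {M : Type*} (S : MultiModeSystem M)

/-- All states that are visited after the initial state `v` are at the border. -/
def StaysAtBorder : ℝ → List (M × ℝ) → Prop
  | _, [] => True
  | v, a :: σ => ¬ S.Inner (S.next v a) ∧ StaysAtBorder (S.next v a) σ

variable {S} {T : ℝ} {σ₀ σ : List (M × ℝ)} {v : ℝ}

lemma staysAtBorder_of_take
    (h : ∀ j < σ.length, ¬ S.Inner ((σ.take (j + 1)).foldl S.next v)) : S.StaysAtBorder v σ := by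
  induction σ generalizing v with
  | nil => trivial
  | cons a σ ih =>
    exact ⟨by simpa using h 0 (by simp), ih fun j hj => by simpa using h (j + 1) (by simpa using hj)⟩

/-- If at most one visited state is not at the border, then the sequence splits there. -/
lemma staysAtBorder_or_split
    (h : ∀ i < σ.length, ∀ j < σ.length, i ≠ j → S.Inner ((σ.take (j + 1)).foldl S.next v) →
      ¬ S.Inner ((σ.take (i + 1)).foldl S.next v)) :
    S.StaysAtBorder v σ ∨ ∃ l₁ a l₂, σ = l₁ ++ a :: l₂ ∧ S.StaysAtBorder v l₁ ∧
      S.Inner (S.next (l₁.foldl S.next v) a) ∧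
      S.StaysAtBorder (S.next (l₁.foldl S.next v) a) l₂ := by
  induction σ generalizing v with
  | nil => exact Or.inl trivial
  | cons a σ ih =>
    by_cases ha : S.Inner (S.next v a)
    · refine Or.inr ⟨[], a, σ, rfl, trivial, ha, staysAtBorder_of_take fun j hj hin => ?_⟩
      exact h 0 (by simp) (j + 1) (by simpa using hj) (by simp) (by simpa using hin) (by simpa using ha)
    · rcases ih (v := S.next v a) fun i hi j hj hij hin => by
          simpa using h (i + 1) (by simpa using hi) (j + 1) (by simpa using hj) (by simpa using hij)
            (by simpa using hin) with hb | ⟨l₁, b, l₂, rfl, h1, h2, h3⟩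
      · exact Or.inl ⟨ha, hb⟩
      · exact Or.inr ⟨a :: l₁, b, l₂, rfl, ⟨ha, h1⟩, h2, h3⟩

/-- A shortest schedule can be chosen such that at most one visited state is not at the border, and
none if it starts with a mode of slope zero. -/
lemma exists_isShortest_staysAtBorder (h : S.IsSafeSchedule T σ₀) :
    ∃ σ, S.IsShortest T σ₀ σ ∧ S.ZeroModeOnlyFirst σ ∧
      ((∃ f σ₁, σ = f :: σ₁ ∧ S.slope f.1 = 0 ∧ S.StaysAtBorder S.v0 σ₁) ∨
        (∀ a ∈ σ, S.slope a.1 ≠ 0) ∧ (S.StaysAtBorder S.v0 σ ∨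
          ∃ l₁ a l₂, σ = l₁ ++ a :: l₂ ∧ S.StaysAtBorder S.v0 l₁ ∧
            S.Inner (S.next (l₁.foldl S.next S.v0) a) ∧
            S.StaysAtBorder (S.next (l₁.foldl S.next S.v0) a) l₂)) := by
  obtain ⟨τ, hτ, hτz⟩ := exists_isShortest_zeroModeOnlyFirst h
  set m : Fin τ.length → M := fun i => (τ.get i).1 with hm
  have hτ' : schedule m (fun i => (τ.get i).2) = τ := List.ofFn_get τ
  rw [← hτ'] at hτ
  obtain ⟨t, hσ, hinner⟩ := hτ.exists_durations
  have hfst : (schedule m t).map Prod.fst = τ.map Prod.fst := by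
    conv_rhs => rw [← hτ']
    simp [schedule, List.map_ofFn, Function.comp_def]
  have hlen : (schedule m t).length = τ.length := by simp [schedule]
  have hz : S.ZeroModeOnlyFirst (schedule m t) := by
    intro a ha
    have : a.1 ∈ (τ.map Prod.fst).tail := by
      rw [← hfst, ← List.map_tail]
      exact List.mem_map_of_mem ha
    rw [← List.map_tail] at this
    obtain ⟨b, hb, hab⟩ := List.mem_map.1 this
    rw [← hab]
    exact hτz b hb
  refine ⟨_, hσ, hz, ?_⟩
  simp only [← foldl_take_schedule] at hinner
  by_cases hflat : ∃ f σ₁, schedule m t = f :: σ₁ ∧ S.slope f.1 = 0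
  · obtain ⟨f, σ₁, hf, hf0⟩ := hflat
    refine Or.inl ⟨f, σ₁, hf, hf0, staysAtBorder_of_take fun j hj hin => ?_⟩
    have hl : σ₁.length + 1 = τ.length := by rw [← hlen, hf]; simp
    -- Position `j` of `σ₁` is position `j + 1` of the whole schedule; the flat action at position
    -- `0` plays the role of the second movable index.
    refine hinner ⟨0, by omega⟩ ⟨j + 1, by omega⟩ (by simp) ?_ (Or.inr ⟨rfl, ?_⟩)
    · simpa [hf, next_of_slope_eq_zero S hf0] using hin
    · have : (schedule m t)[0]'(by omega) = f := by simp [hf]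
      simp only [schedule, List.getElem_ofFn] at this
      rw [← this] at hf0
      exact hf0
  · refine Or.inr ⟨?_, staysAtBorder_or_split fun i hi j hj hij hin hin' => ?_⟩
    · intro a ha ha0
      cases hs : schedule m t with
      | nil => simp [hs] at ha
      | cons f σ₁ =>
        rw [hs, List.mem_cons] at ha
        rcases ha with rfl | ha
        · exact hflat ⟨_, _, hs, ha0⟩
        · exact hz a (by rw [hs]; exact ha) ha0
    · exact hinner ⟨i, hlen ▸ hi⟩ ⟨j, hlen ▸ hj⟩ (by simpa using hij) hin (Or.inl hin')

lemma isLeapsSection_nil : S.IsLeapsSection [] := ⟨[], by simp, rfl⟩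

lemma IsLeapsSection.append {l₁ l₂ : List (M × ℝ)} (h₁ : S.IsLeapsSection l₁)
    (h₂ : S.IsLeapsSection l₂) : S.IsLeapsSection (l₁ ++ l₂) := by
  obtain ⟨L₁, h₁, rfl⟩ := h₁
  obtain ⟨L₂, h₂, rfl⟩ := h₂
  refine ⟨L₁ ++ L₂, fun p hp => ?_, by simp⟩
  rcases List.mem_append.1 hp with hp | hp
  exacts [h₁ p hp, h₂ p hp]

lemma isLeapsSection_pair {a b : M × ℝ} (ha : S.IsStep S.vMin a .up) (hb : S.IsStep S.vMax b .down) :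
    S.IsLeapsSection [a, b] := by
  refine ⟨[(a, b)], ?_, by simp⟩
  simp only [List.mem_singleton, forall_eq, IsLeap]
  simp only [IsStep, next] at ha hb
  exact ⟨ha.1, hb.1, by linarith, by linarith⟩

lemma IsLeapsSection.foldl_next {l : List (M × ℝ)} (h : S.IsLeapsSection l) (v : ℝ) :
    l.foldl S.next v = v := by
  obtain ⟨L, hL, rfl⟩ := h
  induction L generalizing v with
  | nil => rfl
  | cons p L ih =>
    have hp := (hL p (by simp)).2.2.1
    simp only [List.flatMap_cons, List.cons_append, List.nil_append, List.foldl_cons]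
    rw [ih _ (fun q hq => hL q (by simp [hq]))]
    simp only [next]
    linarith

lemma IsLeapsSection.safe {l : List (M × ℝ)} (h : S.IsLeapsSection l) :
    ∀ w ∈ S.runFrom S.vMin l, S.vMin ≤ w ∧ w ≤ S.vMax := by
  have hlt := S.vMin_lt_vMax
  obtain ⟨L, hL, rfl⟩ := h
  induction L with
  | nil => simpa [runFrom] using hlt.le
  | cons p L ih =>
    have hp := hL p (by simp)
    have h1 : S.next S.vMin p.1 = S.vMax := by have := hp.2.2.2; simp only [next]; linarith
    have h2 : S.next S.vMax p.2 = S.vMin := by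
      have := hp.2.2.1
      have := hp.2.2.2
      simp only [next]; linarith
    intro w hw
    simp only [List.flatMap_cons, List.cons_append, List.nil_append, mem_runFrom_cons, h1, h2] at hw
    rcases hw with rfl | rfl | hw
    · exact ⟨le_rfl, hlt.le⟩
    · exact ⟨hlt.le, le_rfl⟩
    · exact ih (fun q hq => hL q (by simp [hq])) w hw

lemma Follows.safe {p : List Step} (h : S.Follows v σ p) (hv : S.vMin ≤ v ∧ v ≤ S.vMax) :
    ∀ w ∈ S.runFrom v σ, S.vMin ≤ w ∧ w ≤ S.vMax := by
  have hlt := S.vMin_lt_vMax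
  induction σ generalizing v p with
  | nil => simpa [runFrom] using hv
  | cons a σ ih =>
    cases p with
    | nil => exact h.elim
    | cons s p =>
      intro w hw
      rcases (mem_runFrom_cons S).1 hw with rfl | hw
      · exact hv
      · refine ih h.2 ?_ w hw
        have ha := h.1
        cases s <;> simp only [IsStep] at ha
        · rwa [next_of_slope_eq_zero S ha]
        · exact ⟨by linarith, by linarith⟩
        · exact ⟨ha.2.1.le, ha.2.2.le⟩
        · exact ⟨by linarith, by linarith⟩
        · exact ⟨ha.2.1.le, ha.2.2.le⟩

/-- Every pattern step keeps the state within the bounds, and the leaps and the tail start at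
`vMin`. Rearrangements thus need no separate check of safety or of the visit to `vMin`. -/
lemma HasForm.safe {h : HeadPattern} {t : TailPattern} (hf : S.HasForm σ h t) :
    (∀ w ∈ S.run σ, S.vMin ≤ w ∧ w ≤ S.vMax) ∧ S.vMin ∈ S.run σ := by
  obtain ⟨head, leaps, tail, rfl, hh, hl, he, ht⟩ := hf
  have he' : head.foldl S.next S.v0 = S.vMin := by
    rw [← he, endState, List.foldl_append, hl.foldl_next]
  rw [endState] at he
  constructor
  · intro w hw
    rw [run, mem_runFrom_append, mem_runFrom_append, he, he'] at hw
    rcases hw with (hw | hw) | hw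
    · exact hh.safe ⟨S.vMin_le_v0, S.v0_le_vMax⟩ w hw
    · exact hl.safe w hw
    · exact ht.safe ⟨le_rfl, S.vMin_lt_vMax.le⟩ w hw
  · rw [run, mem_runFrom_append, he]
    exact Or.inr (S.left_mem_runFrom _ _)

variable (S) in
/-- `σ` has the form given by an admissible pair of patterns of total length at most five. -/
def HasStandardForm (σ : List (M × ℝ)) : Prop :=
  ∃ h t, (h, t) ∈ patternCombinations ∧ h.steps.length + t.steps.length ≤ 5 ∧ S.HasForm σ h t

lemma hasStandardForm_of {head leaps tail : List (M × ℝ)} (h : HeadPattern) (t : TailPattern)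
    (hmem : (h, t) ∈ patternCombinations) (hlen : h.steps.length + t.steps.length ≤ 5)
    (hh : S.Follows S.v0 head h.steps) (he : head.foldl S.next S.v0 = S.vMin)
    (hl : S.IsLeapsSection leaps) (ht : S.Follows S.vMin tail t.steps) :
    S.HasStandardForm (head ++ leaps ++ tail) :=
  ⟨h, t, hmem, hlen, head, leaps, tail, rfl, hh, hl,
    by rw [endState, List.foldl_append, he, hl.foldl_next], ht⟩

variable (S) in
/-- The last step of a schedule that stays at the border: nothing, or a step up. -/
def IsEnd (σ : List (M × ℝ)) : Prop := σ = [] ∨ ∃ u, σ = [u] ∧ S.IsStep S.vMin u .up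

lemma isStep_of_not_inner {a : M × ℝ} (hv : S.vMin ≤ v ∧ v ≤ S.vMax) (ha : S.slope a.1 ≠ 0 ∧ 0 < a.2)
    (h : ¬ S.Inner (S.next v a)) : S.IsStep v a .up ∨ S.IsStep v a .down := by
  have h' : S.next v a = S.vMin ∨ S.next v a = S.vMax := by
    by_contra hc; push Not at hc; exact h hc
  rcases h' with h' | h'
  · refine Or.inr ⟨lt_of_le_of_ne ?_ ha.1, h'⟩
    by_contra! hs
    have := mul_pos hs ha.2
    simp only [next] at h'
    linarith
  · refine Or.inl ⟨lt_of_le_of_ne ?_ ha.1.symm, h'⟩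
    by_contra! hs
    have := mul_neg_of_neg_of_pos hs ha.2
    simp only [next] at h'
    linarith

lemma not_isStep_up_vMax {a : M × ℝ} (ha : 0 < a.2) : ¬ S.IsStep S.vMax a .up := by
  rintro ⟨h1, h2⟩
  have := mul_pos h1 ha
  simp only [next] at h2
  linarith

lemma not_isStep_down_vMin {a : M × ℝ} (ha : 0 < a.2) : ¬ S.IsStep S.vMin a .down := by
  rintro ⟨h1, h2⟩
  have := mul_neg_of_neg_of_pos h1 ha
  simp only [next] at h2
  linarith

/-- A sequence that stays at the border from `vMin` on consists of leaps and at most one step up. -/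
lemma StaysAtBorder.exists_leaps : ∀ {σ : List (M × ℝ)}, S.StaysAtBorder S.vMin σ →
    (∀ a ∈ σ, S.slope a.1 ≠ 0 ∧ 0 < a.2) →
    ∃ L E, σ = L ++ E ∧ S.IsLeapsSection L ∧ S.IsEnd E
  | [], _, _ => ⟨[], [], rfl, isLeapsSection_nil, Or.inl rfl⟩
  | [a], h, hnz => by
    have ha := hnz a (by simp)
    have hup := (isStep_of_not_inner ⟨le_rfl, S.vMin_lt_vMax.le⟩ ha h.1).resolve_right
      (not_isStep_down_vMin ha.2)
    exact ⟨[], [a], rfl, isLeapsSection_nil, Or.inr ⟨a, rfl, hup⟩⟩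
  | a :: b :: σ, h, hnz => by
    have ha := hnz a (by simp)
    have hb := hnz b (by simp)
    have hup := (isStep_of_not_inner ⟨le_rfl, S.vMin_lt_vMax.le⟩ ha h.1).resolve_right
      (not_isStep_down_vMin ha.2)
    obtain ⟨-, h2, h3⟩ := h
    rw [hup.2] at h2 h3
    have hdown := (isStep_of_not_inner ⟨S.vMin_lt_vMax.le, le_rfl⟩ hb h2).resolve_left
      (not_isStep_up_vMax hb.2)
    rw [hdown.2] at h3
    obtain ⟨L, E, rfl, hL, hE⟩ := h3.exists_leaps fun c hc => hnz c (by simp [hc])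
    exact ⟨[a, b] ++ L, E, by simp, (isLeapsSection_pair hup hdown).append hL, hE⟩

/-- The start `v` may lie off the border, so both directions are possible at first. Once `vMax` is
reached the next step must be down, and from `vMin` on `StaysAtBorder.exists_leaps` applies. -/
lemma StaysAtBorder.cases (h : S.StaysAtBorder v σ) (hv : S.vMin ≤ v ∧ v ≤ S.vMax)
    (hnz : ∀ a ∈ σ, S.slope a.1 ≠ 0 ∧ 0 < a.2) :
    σ = [] ∨ (∃ b, σ = [b] ∧ S.IsStep v b .up) ∨
      (∃ b L E, σ = b :: (L ++ E) ∧ S.IsStep v b .down ∧ S.IsLeapsSection L ∧ S.IsEnd E) ∨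
      ∃ b d L E, σ = b :: d :: (L ++ E) ∧ S.IsStep v b .up ∧ S.IsStep S.vMax d .down ∧
        S.IsLeapsSection L ∧ S.IsEnd E := by
  cases σ with
  | nil => exact Or.inl rfl
  | cons b σ =>
    refine Or.inr ?_
    obtain ⟨h1, h2⟩ := h
    rcases isStep_of_not_inner hv (hnz b (by simp)) h1 with hb | hb
    · rw [hb.2] at h2
      cases σ with
      | nil => exact Or.inl ⟨b, rfl, hb⟩
      | cons d σ =>
        have hd := hnz d (by simp)
        obtain ⟨h2, h3⟩ := h2
        have hdown := (isStep_of_not_inner ⟨S.vMin_lt_vMax.le, le_rfl⟩ hd h2).resolve_left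
          (not_isStep_up_vMax hd.2)
        rw [hdown.2] at h3
        obtain ⟨L, E, rfl, hL, hE⟩ := h3.exists_leaps fun c hc => hnz c (by simp [hc])
        exact Or.inr (Or.inr ⟨b, d, L, E, rfl, hb, hdown, hL, hE⟩)
    · rw [hb.2] at h2
      obtain ⟨L, E, rfl, hL, hE⟩ := h2.exists_leaps fun c hc => hnz c (by simp [hc])
      exact Or.inr (Or.inl ⟨b, L, E, rfl, hb, hL, hE⟩)

end MultiModeSystem

/-! ### Rearrangement into the head and tail patterns -/

namespace MultiModeSystem

variable {M : Type*} {S : MultiModeSystem M} {T : ℝ} {σ₀ σ : List (M × ℝ)}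

/-- The schedule can be rearranged into standard form. -/
lemma exists_perm_of_partialUp {H L l : List (M × ℝ)} {a : M × ℝ} {x : ℝ} (h : HeadPattern)
    (hh : h = .down ∨ h = .up_down ∨ h = .empty) (hH : S.Follows S.v0 H h.steps)
    (hHe : H.foldl S.next S.v0 = S.vMin) (hL : S.IsLeapsSection L)
    (ha : 0 < S.slope a.1) (hax : S.next S.vMin a = x) (hx : S.vMin < x ∧ x < S.vMax)
    (hl : S.StaysAtBorder x l) (hnz : ∀ a ∈ l, S.slope a.1 ≠ 0 ∧ 0 < a.2) :
    ∃ σ', σ'.Perm (H ++ L ++ a :: l) ∧ S.HasStandardForm σ' := by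
  classical
  have hmem (t : TailPattern) : (h, t) ∈ patternCombinations := by
    simp [patternCombinations, hh]
  have hlen (t : TailPattern) (ht : t.steps.length ≤ 3) : h.steps.length + t.steps.length ≤ 5 := by
    have : h.steps.length ≤ 2 := by rcases hh with rfl | rfl | rfl <;> simp [HeadPattern.steps]
    omega
  have ha' : S.IsStep S.vMin a .partialUp := ⟨ha, by rw [hax]; exact hx⟩
  rcases hl.cases ⟨hx.1.le, hx.2.le⟩ hnz with rfl | ⟨c, rfl, hc⟩ | ⟨c, L', E, rfl, hc, hL', hE⟩ |
    ⟨c, d, L', E, rfl, hc, hd, hL', hE⟩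
  · exact ⟨_, .rfl, hasStandardForm_of h .partialUp (hmem _) (hlen _ (by decide)) hH hHe hL
      ⟨ha', trivial⟩⟩
  · exact ⟨_, .rfl, hasStandardForm_of h .partialUp_up (hmem _) (hlen _ (by decide)) hH hHe hL
      ⟨ha', hax ▸ hc, trivial⟩⟩
  · have hc' : S.IsStep (S.next S.vMin a) c .down := hax ▸ hc
    rcases hE with rfl | ⟨u, rfl, hu⟩
    · refine ⟨_, ?_, hasStandardForm_of (leaps := L ++ L') (tail := [a, c]) h .partialUp_down
        (hmem _) (hlen _ (by decide)) hH hHe (hL.append hL') ⟨ha', hc', trivial⟩⟩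
      refine List.perm_iff_count.2 fun z => ?_
      simp only [List.count_append, List.count_cons, List.count_nil]; ring
    · refine ⟨_, ?_, hasStandardForm_of (leaps := L ++ L') (tail := [a, c, u]) h .partialUp_down_up
        (hmem _) (hlen _ (by decide)) hH hHe (hL.append hL') ⟨ha', hc', ?_, trivial⟩⟩
      · refine List.perm_iff_count.2 fun z => ?_
        simp only [List.count_append, List.count_cons, List.count_nil]; ring
      · rw [hc'.2]; exact hu
  · have hc' : S.IsStep (S.next S.vMin a) c .up := hax ▸ hc
    rcases hE with rfl | ⟨u, rfl, hu⟩
    · refine ⟨_, ?_, hasStandardForm_of (leaps := L ++ L') (tail := [a, c, d]) h .partialUp_up_down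
        (hmem _) (hlen _ (by decide)) hH hHe (hL.append hL') ⟨ha', hc', ?_, trivial⟩⟩
      · refine List.perm_iff_count.2 fun z => ?_
        simp only [List.count_append, List.count_cons, List.count_nil]; ring
      · rw [hc'.2]; exact hd
    -- The final step up `u` joins `d` to form a leap before the tail, which then ends at `vMax`
    -- after `a`, `c`.
    · refine ⟨_, ?_, hasStandardForm_of (leaps := L ++ [u, d] ++ L') (tail := [a, c]) h
        .partialUp_up (hmem _) (hlen _ (by decide)) hH hHe
        ((hL.append (isLeapsSection_pair hu hd)).append hL') ⟨ha', hc', trivial⟩⟩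
      refine List.perm_iff_count.2 fun z => ?_
      simp only [List.count_append, List.count_cons, List.count_nil]; ring

/-- A partial step down from the upper border, followed by a step up back to it, can be moved to the
lower border, in the reverse order. -/
lemma follows_partialUp_down {a c : M × ℝ} {x : ℝ} (ha : S.slope a.1 < 0)
    (hax : S.next S.vMax a = x) (hx : S.vMin < x ∧ x < S.vMax) (hc : S.IsStep x c .up) :
    S.IsStep S.vMin c .partialUp ∧ S.IsStep (S.next S.vMin c) a .down := by
  simp only [IsStep, next] at *
  refine ⟨⟨hc.1, ?_, ?_⟩, ha, ?_⟩ <;> linarith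

/-- The state off the border is reached from `vMax`. If the run returns to `vMax`, the excursion is
turned over by `follows_partialUp_down`, which frees `u` to end the schedule or to form a leap. -/
lemma exists_perm_of_partialDown {H L l : List (M × ℝ)} {a u : M × ℝ} {x : ℝ} (h : HeadPattern)
    (hh : h = .down ∨ h = .up_down ∨ h = .empty) (hH : S.Follows S.v0 H h.steps)
    (hHe : H.foldl S.next S.v0 = S.vMin) (hL : S.IsLeapsSection L) (hu : S.IsStep S.vMin u .up)
    (ha : S.slope a.1 < 0) (hax : S.next S.vMax a = x) (hx : S.vMin < x ∧ x < S.vMax)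
    (hl : S.StaysAtBorder x l) (hnz : ∀ a ∈ l, S.slope a.1 ≠ 0 ∧ 0 < a.2) :
    ∃ σ', σ'.Perm (H ++ (L ++ [u]) ++ a :: l) ∧ S.HasStandardForm σ' := by
  classical
  have hmem (t : TailPattern) : (h, t) ∈ patternCombinations := by
    simp [patternCombinations, hh]
  have hlen (t : TailPattern) (ht : t.steps.length ≤ 3) : h.steps.length + t.steps.length ≤ 5 := by
    have : h.steps.length ≤ 2 := by rcases hh with rfl | rfl | rfl <;> simp [HeadPattern.steps]
    omega
  have ha' : S.IsStep (S.next S.vMin u) a .partialDown := by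
    rw [hu.2]; exact ⟨ha, by rw [hax]; exact hx⟩
  rcases hl.cases ⟨hx.1.le, hx.2.le⟩ hnz with rfl | ⟨c, rfl, hc⟩ | ⟨c, L', E, rfl, hc, hL', hE⟩ |
    ⟨c, d, L', E, rfl, hc, hd, hL', hE⟩
  · refine ⟨_, ?_, hasStandardForm_of (tail := [u, a]) h .up_partialDown (hmem _)
      (hlen _ (by decide)) hH hHe hL ⟨hu, ha', trivial⟩⟩
    simp
  · obtain ⟨h1, h2⟩ := follows_partialUp_down ha hax hx hc
    refine ⟨_, ?_, hasStandardForm_of (tail := [c, a, u]) h .partialUp_down_up (hmem _)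
      (hlen _ (by decide)) hH hHe hL ⟨h1, h2, by rw [h2.2]; exact hu, trivial⟩⟩
    refine List.perm_iff_count.2 fun z => ?_
    simp only [List.count_append, List.count_cons, List.count_nil]; ring
  · have hc' : S.IsStep (S.next (S.next S.vMin u) a) c .down := by rw [hu.2, hax]; exact hc
    rcases hE with rfl | ⟨u', rfl, hu'⟩
    · refine ⟨_, ?_, hasStandardForm_of (leaps := L ++ L') (tail := [u, a, c]) h
        .up_partialDown_down (hmem _) (hlen _ (by decide)) hH hHe (hL.append hL')
        ⟨hu, ha', hc', trivial⟩⟩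
      refine List.perm_iff_count.2 fun z => ?_
      simp only [List.count_append, List.count_cons, List.count_nil]; ring
    -- Head `up_down` with the four-step tail would have length six. Instead the partial descent
    -- `a`, `c` is exchanged with the head's step down `d`: the head becomes `b`, `a`, `c`, and `u`,
    -- `d` form a leap.
    · by_cases hup : h = .up_down
      · subst hup
        match H, hH with
        | [b, d], hH =>
          obtain ⟨hb, hd, -⟩ := hH
          have hd' : S.IsStep S.vMax d .down := by rw [← hb.2]; exact hd
          refine ⟨_, ?_, hasStandardForm_of (head := [b, a, c]) (leaps := [u, d] ++ L ++ L')
            (tail := [u']) .up_partialDown_down .up (by simp [patternCombinations]) (by decide)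
            ⟨hb, ?_, ?_, trivial⟩ ?_ (((isLeapsSection_pair hu hd').append hL).append hL')
            ⟨hu', trivial⟩⟩
          · refine List.perm_iff_count.2 fun z => ?_
            simp only [List.count_append, List.count_cons, List.count_nil]; ring
          · rw [hb.2]; rwa [hu.2] at ha'
          · rw [hb.2, hax]; exact hc
          · simp only [List.foldl_cons, List.foldl_nil]
            rw [hb.2, hax]; exact hc.2
      · refine ⟨_, ?_, hasStandardForm_of (leaps := L ++ L') (tail := [u, a, c, u']) h
          .up_partialDown_down_up (hmem _) ?_ hH hHe (hL.append hL')
          ⟨hu, ha', hc', ?_, trivial⟩⟩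
        · refine List.perm_iff_count.2 fun z => ?_
          simp only [List.count_append, List.count_cons, List.count_nil]; ring
        · rcases hh with rfl | rfl | rfl
          · decide
          · exact absurd rfl hup
          · decide
        · rw [hc'.2]; exact hu'
  · obtain ⟨h1, h2⟩ := follows_partialUp_down ha hax hx hc
    have hleaps := (hL.append (isLeapsSection_pair hu hd)).append hL'
    rcases hE with rfl | ⟨u', rfl, hu'⟩
    · refine ⟨_, ?_, hasStandardForm_of (tail := [c, a]) h .partialUp_down (hmem _)
        (hlen _ (by decide)) hH hHe hleaps ⟨h1, h2, trivial⟩⟩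
      refine List.perm_iff_count.2 fun z => ?_
      simp only [List.count_append, List.count_cons, List.count_nil]; ring
    · refine ⟨_, ?_, hasStandardForm_of (tail := [c, a, u']) h .partialUp_down_up (hmem _)
        (hlen _ (by decide)) hH hHe hleaps ⟨h1, h2, by rw [h2.2]; exact hu', trivial⟩⟩
      refine List.perm_iff_count.2 fun z => ?_
      simp only [List.count_append, List.count_cons, List.count_nil]; ring

/-- Heads that are followed by leaps and at most one further step up. -/
lemma hasStandardForm_of_isEnd {H L E : List (M × ℝ)} (h : HeadPattern)
    (hlen : h.steps.length ≤ 3) (hH : S.Follows S.v0 H h.steps)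
    (hHe : H.foldl S.next S.v0 = S.vMin) (hL : S.IsLeapsSection L) (hE : S.IsEnd E) :
    S.HasStandardForm (H ++ L ++ E) := by
  rcases hE with rfl | ⟨u, rfl, hu⟩
  · exact hasStandardForm_of h .empty (by simp [patternCombinations])
      (by simp [TailPattern.steps]; omega) hH hHe hL trivial
  · exact hasStandardForm_of h .up (by simp [patternCombinations])
      (by simp [TailPattern.steps]; omega) hH hHe hL ⟨hu, trivial⟩

variable (S) in
/-- The conclusion of the main theorem about the shape of a schedule, up to rearrangement. -/
def IsRearrangeable (σ : List (M × ℝ)) : Prop :=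
  (∃ σ', σ'.Perm σ ∧ S.HasStandardForm σ') ∨
    ((S.v0 = S.vMin ∨ S.vMin ∉ S.run σ) ∧ σ.length ≤ 2) ∨
    (S.vMin ∉ S.run σ ∧ S.Follows S.v0 σ [.up, .partialDown, .up])

lemma StaysAtBorder.isRearrangeable (h : S.StaysAtBorder S.v0 σ)
    (hnz : ∀ a ∈ σ, S.slope a.1 ≠ 0 ∧ 0 < a.2) : S.IsRearrangeable σ := by
  have hlt := S.vMin_lt_vMax
  rcases h.cases ⟨S.vMin_le_v0, S.v0_le_vMax⟩ hnz with rfl | ⟨b, rfl, hb⟩ |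
    ⟨b, L, E, rfl, hb, hL, hE⟩ | ⟨b, d, L, E, rfl, hb, hd, hL, hE⟩
  -- The run consists of `v0` alone, so it visits `vMin` only if `v0` is `vMin`; the disjunction is
  -- excluded middle.
  · refine Or.inr (Or.inl ⟨?_, by simp⟩)
    simp only [run, runFrom, List.mem_singleton, eq_comm (a := S.vMin)]
    exact em _
  · refine Or.inr (Or.inl ⟨?_, by simp⟩)
    simp only [run, runFrom, List.mem_cons, List.not_mem_nil, or_false, hb.2, hlt.ne,
      eq_comm (a := S.vMin) (b := S.v0)]
    exact em _
  · exact Or.inl ⟨_, .rfl, hasStandardForm_of_isEnd (H := [b]) .down (by decide) ⟨hb, trivial⟩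
      hb.2 hL hE⟩
  · have hd' : S.IsStep (S.next S.v0 b) d .down := by rw [hb.2]; exact hd
    exact Or.inl ⟨_, .rfl, hasStandardForm_of_isEnd (H := [b, d]) .up_down (by decide)
      ⟨hb, hd', trivial⟩ hd'.2 hL hE⟩

lemma slope_pos_of_lt_next {v : ℝ} {a : M × ℝ} (ha : 0 < a.2) (h : v < S.next v a) :
    0 < S.slope a.1 := by
  simp only [next] at h
  exact pos_of_mul_pos_left (b := a.2) (by linarith) ha.le

lemma slope_neg_of_next_lt {v : ℝ} {a : M × ℝ} (ha : 0 < a.2) (h : S.next v a < v) :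
    S.slope a.1 < 0 := by
  simp only [next] at h
  by_contra! hs
  have := mul_nonneg hs ha.le
  linarith

lemma isRearrangeable_of_inner_first {a : M × ℝ} {l : List (M × ℝ)}
    (ha : S.slope a.1 ≠ 0) (hx : S.vMin < S.next S.v0 a ∧ S.next S.v0 a < S.vMax)
    (hl : S.StaysAtBorder (S.next S.v0 a) l) (hnz : ∀ a ∈ l, S.slope a.1 ≠ 0 ∧ 0 < a.2) :
    S.IsRearrangeable (a :: l) := by
  have hlt := S.vMin_lt_vMax
  rcases hl.cases ⟨hx.1.le, hx.2.le⟩ hnz with rfl | ⟨c, rfl, hc⟩ | ⟨c, L, E, rfl, hc, hL, hE⟩ |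
    ⟨c, d, L, E, rfl, hc, hd, hL, hE⟩
  · refine Or.inr (Or.inl ⟨?_, by simp⟩)
    simp only [run, runFrom, List.mem_cons, List.not_mem_nil, or_false, hx.1.ne,
      eq_comm (a := S.vMin) (b := S.v0)]
    exact em _
  · refine Or.inr (Or.inl ⟨?_, by simp⟩)
    simp only [run, runFrom, List.mem_cons, List.not_mem_nil, or_false, hx.1.ne, hc.2, hlt.ne,
      eq_comm (a := S.vMin) (b := S.v0)]
    exact em _
  · rcases ha.lt_or_gt with ha | ha
    · exact Or.inl ⟨_, .rfl, hasStandardForm_of_isEnd (H := [a, c]) .partialDown_down (by decide)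
        ⟨⟨ha, hx⟩, hc, trivial⟩ hc.2 hL hE⟩
    · exact Or.inl ⟨_, .rfl, hasStandardForm_of_isEnd (H := [a, c]) .partialUp_down (by decide)
        ⟨⟨ha, hx⟩, hc, trivial⟩ hc.2 hL hE⟩
  · have hd' : S.IsStep (S.next (S.next S.v0 a) c) d .down := by rw [hc.2]; exact hd
    rcases ha.lt_or_gt with ha | ha
    · exact Or.inl ⟨_, .rfl, hasStandardForm_of_isEnd (H := [a, c, d]) .partialDown_up_down
        (by decide) ⟨⟨ha, hx⟩, hc, hd', trivial⟩ hd'.2 hL hE⟩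
    · exact Or.inl ⟨_, .rfl, hasStandardForm_of_isEnd (H := [a, c, d]) .partialUp_up_down
        (by decide) ⟨⟨ha, hx⟩, hc, hd', trivial⟩ hd'.2 hL hE⟩

/-- For `v0` off `vMin`, up, partial down, up never meets `vMin` and is the exceptional shape. If a
step down follows these three, it can be used directly after the first step up, and the turned-over
excursion moves to the tail. -/
lemma isRearrangeable_of_up_inner {a b : M × ℝ} {l : List (M × ℝ)} {x : ℝ}
    (hb : S.IsStep S.v0 b .up) (ha : S.slope a.1 < 0) (hax : S.next S.vMax a = x)
    (hx : S.vMin < x ∧ x < S.vMax)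
    (hl : S.StaysAtBorder x l) (hnz : ∀ a ∈ l, S.slope a.1 ≠ 0 ∧ 0 < a.2) :
    S.IsRearrangeable (b :: a :: l) := by
  classical
  have hlt := S.vMin_lt_vMax
  by_cases h0 : S.v0 = S.vMin
  · exact Or.inl (exists_perm_of_partialDown (H := []) (L := []) .empty (by simp) trivial h0
      isLeapsSection_nil (h0 ▸ hb) ha hax hx hl hnz)
  have ha' : S.IsStep (S.next S.v0 b) a .partialDown := by
    rw [hb.2]; exact ⟨ha, by rw [hax]; exact hx⟩
  have h0' : S.vMin ≠ S.v0 := fun h => h0 h.symm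
  rcases hl.cases ⟨hx.1.le, hx.2.le⟩ hnz with rfl | ⟨c, rfl, hc⟩ | ⟨c, L, E, rfl, hc, hL, hE⟩ |
    ⟨c, d, L, E, rfl, hc, hd, hL, hE⟩
  · refine Or.inr (Or.inl ⟨Or.inr ?_, by simp⟩)
    simp [run, runFrom, hb.2, hax, hlt.ne, hx.1.ne, h0']
  · refine Or.inr (Or.inr ⟨?_, hb, ha', ?_, trivial⟩)
    · simp [run, runFrom, hb.2, hax, hlt.ne, hx.1.ne, h0', hc.2]
    · rw [hb.2, hax]; exact hc
  · have hc' : S.IsStep (S.next (S.next S.v0 b) a) c .down := by rw [hb.2, hax]; exact hc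
    exact Or.inl ⟨_, .rfl, hasStandardForm_of_isEnd (H := [b, a, c]) .up_partialDown_down
      (by decide) ⟨hb, ha', hc', trivial⟩ hc'.2 hL hE⟩
  · obtain ⟨h1, h2⟩ := follows_partialUp_down ha hax hx hc
    have hd' : S.IsStep (S.next S.v0 b) d .down := by rw [hb.2]; exact hd
    refine Or.inl ?_
    rcases hE with rfl | ⟨u, rfl, hu⟩
    · refine ⟨_, ?_, hasStandardForm_of (head := [b, d]) (tail := [c, a]) .up_down .partialUp_down
        (by simp [patternCombinations]) (by decide) ⟨hb, hd', trivial⟩ hd'.2 hL ⟨h1, h2, trivial⟩⟩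
      refine List.perm_iff_count.2 fun z => ?_
      simp only [List.count_append, List.count_cons, List.count_nil]; ring
    · refine ⟨_, ?_, hasStandardForm_of (head := [b, d]) (tail := [c, a, u]) .up_down
        .partialUp_down_up (by simp [patternCombinations]) (by decide) ⟨hb, hd', trivial⟩ hd'.2 hL
        ⟨h1, h2, by rw [h2.2]; exact hu, trivial⟩⟩
      refine List.perm_iff_count.2 fun z => ?_
      simp only [List.count_append, List.count_cons, List.count_nil]; ring

/-- The case in which the lower border is visited before the only state off the border. -/
lemma exists_perm_of_inner_after_head {H L E l : List (M × ℝ)} {a : M × ℝ} (h : HeadPattern)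
    (hh : h = .down ∨ h = .up_down ∨ h = .empty) (hH : S.Follows S.v0 H h.steps)
    (hHe : H.foldl S.next S.v0 = S.vMin) (hL : S.IsLeapsSection L) (hE : S.IsEnd E)
    (ha : 0 < a.2) (hx : S.vMin < S.next ((H ++ (L ++ E)).foldl S.next S.v0) a ∧
      S.next ((H ++ (L ++ E)).foldl S.next S.v0) a < S.vMax)
    (hl : S.StaysAtBorder (S.next ((H ++ (L ++ E)).foldl S.next S.v0) a) l)
    (hnz : ∀ a ∈ l, S.slope a.1 ≠ 0 ∧ 0 < a.2) :
    ∃ σ', σ'.Perm (H ++ (L ++ E) ++ a :: l) ∧ S.HasStandardForm σ' := by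
  rw [List.foldl_append, hHe, List.foldl_append, hL.foldl_next] at hx hl
  rcases hE with rfl | ⟨u, rfl, hu⟩
  · simp only [List.foldl_nil] at hx hl
    simpa using exists_perm_of_partialUp h hh hH hHe hL (slope_pos_of_lt_next ha hx.1) rfl hx hl hnz
  · simp only [List.foldl_cons, List.foldl_nil, hu.2] at hx hl
    exact exists_perm_of_partialDown h hh hH hHe hL hu (slope_neg_of_next_lt ha hx.2) rfl hx hl hnz

/-- The part `l₁` before the exceptional state decides: it is empty, a single step up, or it has
already reached `vMin`. In the last case the exceptional state belongs to the tail. -/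
lemma isRearrangeable_of_inner {l₁ l₂ : List (M × ℝ)} {a : M × ℝ}
    (h₁ : S.StaysAtBorder S.v0 l₁) (h₂ : S.StaysAtBorder (S.next (l₁.foldl S.next S.v0) a) l₂)
    (hx : S.vMin < S.next (l₁.foldl S.next S.v0) a ∧ S.next (l₁.foldl S.next S.v0) a < S.vMax)
    (hnz : ∀ b ∈ l₁ ++ a :: l₂, S.slope b.1 ≠ 0 ∧ 0 < b.2) :
    S.IsRearrangeable (l₁ ++ a :: l₂) := by
  have hnz₂ : ∀ b ∈ l₂, S.slope b.1 ≠ 0 ∧ 0 < b.2 := fun b hb => hnz b (by simp [hb])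
  have ha := hnz a (by simp)
  rcases h₁.cases ⟨S.vMin_le_v0, S.v0_le_vMax⟩ (fun b hb => hnz b (by simp [hb])) with rfl |
    ⟨b, rfl, hb⟩ | ⟨b, L, E, rfl, hb, hL, hE⟩ | ⟨b, d, L, E, rfl, hb, hd, hL, hE⟩
  · exact isRearrangeable_of_inner_first ha.1 hx h₂ hnz₂
  · simp only [List.foldl_cons, List.foldl_nil, hb.2] at hx h₂
    exact isRearrangeable_of_up_inner hb (slope_neg_of_next_lt ha.2 hx.2) rfl hx h₂ hnz₂
  · exact Or.inl (exists_perm_of_inner_after_head (H := [b]) .down (by simp) ⟨hb, trivial⟩ hb.2 hL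
      hE ha.2 hx h₂ hnz₂)
  · have hd' : S.IsStep (S.next S.v0 b) d .down := by rw [hb.2]; exact hd
    exact Or.inl (exists_perm_of_inner_after_head (H := [b, d]) .up_down (by simp)
      ⟨hb, hd', trivial⟩ hd'.2 hL hE ha.2 hx h₂ hnz₂)

/-- A rearrangement into standard form is again a shortest schedule. -/
lemma IsShortest.of_perm {σ' : List (M × ℝ)} (h : S.IsShortest T σ₀ σ) (hp : σ'.Perm σ)
    (hs : S.HasStandardForm σ') : S.IsShortest T σ₀ σ' := by
  obtain ⟨_, _, -, -, hf⟩ := hs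
  obtain ⟨⟨⟨⟨hpos, hsum⟩, -⟩, hcost, -⟩, hmin⟩ := h
  refine ⟨⟨⟨⟨fun a ha => hpos a (hp.mem_iff.1 ha), ?_⟩, hf.safe.1⟩, ?_, fun _ => hf.safe.2⟩,
    fun τ hτ => hp.length_eq ▸ hmin τ hτ⟩
  · rw [← hsum]; exact (hp.map _).sum_eq
  · rw [cost, (hp.map _).sum_eq]; exact hcost

/-- A schedule that starts with a mode of slope zero and otherwise stays at the border. -/
lemma hasStandardForm_or_of_flat {f : M × ℝ} (hf : S.slope f.1 = 0) (h : S.StaysAtBorder S.v0 σ)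
    (hnz : ∀ a ∈ σ, S.slope a.1 ≠ 0 ∧ 0 < a.2) :
    S.HasStandardForm (f :: σ) ∨
      ((S.v0 = S.vMin ∨ S.vMin ∉ S.run (f :: σ)) ∧ (f :: σ).length ≤ 2) := by
  have hlt := S.vMin_lt_vMax
  have hf' : S.next S.v0 f = S.v0 := S.next_of_slope_eq_zero hf
  rcases h.cases ⟨S.vMin_le_v0, S.v0_le_vMax⟩ hnz with rfl | ⟨b, rfl, hb⟩ |
    ⟨b, L, E, rfl, hb, hL, hE⟩ | ⟨b, d, L, E, rfl, hb, hd, hL, hE⟩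
  · refine Or.inr ⟨?_, by simp⟩
    simp only [run, runFrom, List.mem_cons, List.not_mem_nil, or_false, or_self, hf',
      eq_comm (a := S.vMin)]
    exact em _
  · refine Or.inr ⟨?_, by simp⟩
    simp only [run, runFrom, List.mem_cons, List.not_mem_nil, or_false, or_self, hf', hb.2, hlt.ne,
      eq_comm (a := S.vMin) (b := S.v0)]
    exact em _
  · have hb' : S.IsStep (S.next S.v0 f) b .down := hf'.symm ▸ hb
    exact Or.inl (hasStandardForm_of_isEnd (H := [f, b]) .flat_down (by decide)
      ⟨hf, hb', trivial⟩ hb'.2 hL hE)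
  · have hb' : S.IsStep (S.next S.v0 f) b .up := hf'.symm ▸ hb
    have hd' : S.IsStep (S.next (S.next S.v0 f) b) d .down := by rw [hb'.2]; exact hd
    exact Or.inl (hasStandardForm_of_isEnd (H := [f, b, d]) .flat_up_down (by decide)
      ⟨hf, hb', hd', trivial⟩ hd'.2 hL hE)

end MultiModeSystem

theorem mainTheorem1 {M : Type*} [Finite M] (S : MultiModeSystem M) :
    patternCombinations.card = 44 ∧
    ∀ (T : ℝ) (σ : List (M × ℝ)), S.IsSafeSchedule T σ →
      ∃ σ' : List (M × ℝ), S.IsSafeSchedule T σ' ∧ S.cost σ' ≤ S.cost σ ∧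
        S.IsAngular σ' ∧ S.ZeroModeOnlyFirst σ' ∧
        ((∃ h t, (h, t) ∈ patternCombinations ∧ h.steps.length + t.steps.length ≤ 5 ∧
            S.HasForm σ' h t) ∨
          ((S.v0 = S.vMin ∨ S.vMin ∉ S.run σ) ∧ σ'.length ≤ 2) ∨
          (S.vMin ∉ S.run σ ∧ S.Follows S.v0 σ' [.up, .partialDown, .up])) := by
  refine ⟨by decide, fun T σ hσ => ?_⟩
  obtain ⟨τ, hτ, hz, hτ'⟩ := MultiModeSystem.exists_isShortest_staysAtBorder hσ
  have hpos := hτ.1.1.1.1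
  -- Domination preserves visits to `vMin`; the contrapositive carries the exceptional cases from
  -- the run of `τ` back to that of `σ`.
  have hvis : S.vMin ∉ S.run τ → S.vMin ∉ S.run σ := mt hτ.1.2.2
  rcases hτ' with ⟨f, τ₁, rfl, hf, hb⟩ | ⟨hnz, hτ'⟩
  · refine ⟨_, hτ.1.1, hτ.1.2.1, hτ.isAngular, hz, ?_⟩
    rcases MultiModeSystem.hasStandardForm_or_of_flat hf hb
      fun a ha => ⟨hz a ha, hpos a (by simp [ha])⟩ with h | ⟨h, hlen⟩
    · exact Or.inl h
    · exact Or.inr (Or.inl ⟨h.imp_right hvis, hlen⟩)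
  · have hr : S.IsRearrangeable τ := by
      rcases hτ' with hb | ⟨l₁, a, l₂, rfl, h₁, hin, h₂⟩
      · exact hb.isRearrangeable fun a ha => ⟨hnz a ha, hpos a ha⟩
      · refine MultiModeSystem.isRearrangeable_of_inner h₁ h₂ ?_
          fun a ha => ⟨hnz a ha, hpos a ha⟩
        have hx := hτ.1.1.2 (S.next (l₁.foldl S.next S.v0) a) (by
          rw [MultiModeSystem.run, MultiModeSystem.mem_runFrom_append,
            MultiModeSystem.mem_runFrom_cons]
          exact Or.inr (Or.inr (S.left_mem_runFrom _ _)))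
        exact ⟨lt_of_le_of_ne hx.1 hin.1.symm, lt_of_le_of_ne hx.2 hin.2⟩
    rcases hr with ⟨τ', hp, hs⟩ | ⟨h, hlen⟩ | ⟨h, hfol⟩
    · have hτ' := hτ.of_perm hp hs
      exact ⟨τ', hτ'.1.1, hτ'.1.2.1, hτ'.isAngular,
        fun a ha => hnz a (hp.mem_iff.1 (List.mem_of_mem_tail ha)), Or.inl hs⟩
    · exact ⟨τ, hτ.1.1, hτ.1.2.1, hτ.isAngular, hz, Or.inr (Or.inl ⟨h.imp_right hvis, hlen⟩)⟩
    · exact ⟨τ, hτ.1.1, hτ.1.2.1, hτ.isAngular, hz, Or.inr (Or.inr ⟨hvis h, hfol⟩)⟩
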